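/- **MPNL.** Let $\mathcal{AP}$ be a set of atomic propositions. Formulae of MPNL are generated by $\varphi ::= len_{<k} \mid p \mid \neg\varphi \mid \varphi\vee\varphi \mid \lozenge_l\varphi \mid \lozenge_r\varphi$, with $p\in\mathcal{AP}$, $k\in\mathbb{N}$. The length $|\varphi|$ is the number of symbols of $\varphi$, metric parameters $k$ being written in binary, and $k_\varphi$ is the greatest $k$ occurring in $\varphi$ ($0$ if there is none). The closure $Cl(\varphi)$ is the set of all subformulae of $\varphi$ and of their negations, the negation of $\neg\alpha$ being $\alpha$. A *$\varphi$-atom* is a non-empty set $F\subseteq Cl(\varphi)$ such that (1) for every $\alpha\in Cl(\varphi)$, $\alpha\in F$ iff $\neg\alpha\notin F$; (2) for every $\alpha\vee\beta\in Cl(\varphi)$, $\alpha\vee\beta\in F$ iff $\alpha\in F$ or $\beta\in F$; (3) if $len_{<k},len_{<k'}\in Cl(\varphi)$, $k<k'$ and $len_{<k}\in F$, then $len_{<k'}\in F$. For $\circ\in\{l,r\}$ put $Obs_\circ(F)=\{\psi\in F : \lozenge_\circ\psi\in Cl(\varphi)\}$ and $Req_\circ(F)=\{\psi\in Cl(\varphi)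 : \lozenge_\circ\psi\in F\}$. A *finite compass $\varphi$-structure* $\mathcal{G}=(\mathbb{P}_{\mathbb{D}},\mathcal{L})$ consists of a domain $D=\{0,\dots,y_{max}\}\subset\mathbb{N}$, the set of points $\mathbb{P}_{\mathbb{D}}=\{(x,y): x,y\in D,\ x\le y\}$, and a map $\mathcal{L}$ from points to $\varphi$-atoms such that $Obs_r(\mathcal{L}(y,z))\subseteq Req_r(\mathcal{L}(x,y))$ and $Obs_l(\mathcal{L}(x,y))\subseteq Req_l(\mathcal{L}(y,z))$ for all $x\le y\le z$ in $D$, and $len_{<k}\in\mathcal{L}(x,y)$ implies $y-x<k$. It *features* $\psi$ if $\psi\in\mathcal{L}(x,y)$ for some point $(x,y)$. The *marking* of a point is $\mathcal{M}(x,y)=(\mathcal{L}(x,y),\Psi,\min(y-x,k_\varphi))$, where $\Psi$ is the set of all $\psi\in Req_r(\mathcal{L}(x,x))$ such that $\psi\notin\mathcal{L}(x,y')$ for every $x\le y'\le y$. For a marked atom $t$ (a value of $\mathcal{M}$), let $\mathcal{C}_y(t)=|\{x : \mathcal{M}(x,y)=t\}|$. An *$\mathbb{N}$-compass generator* for $\varphi$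 is a finite compass $\varphi$-structure that features $\varphi$ and is such that 1. for every point $(x,y)$ and every $\psi\in Req_l(\mathcal{L}(x,y))$ there is $z\le x$ with $\psi\in\mathcal{L}(z,x)$; 2. there is $y_{inf}\in D$ with $y_{max}-y_{inf}\ge k_\varphi$ such that (a) for every marked atom $t$, $\mathcal{C}_{y_{max}}(t)>0$ implies $\mathcal{C}_{y_{inf}}(t)>0$, and (b) for every $0\le x\le y_{inf}$, the second component of $\mathcal{M}(x,y_{max})$ is $\emptyset$. **Theorem.** Let $\varphi$ be an MPNL formula. If there exists an $\mathbb{N}$-compass generator that features $\varphi$, then there exists an $\mathbb{N}$-compass generator $\mathcal{G}'=(\mathbb{P}_{\mathbb{D}'},\mathcal{L}')$ that features $\varphi$ with $$|D'|\le \left(2^{3|\varphi|}+2\right)\cdot\left(\frac{|\varphi|^2}{4}+\frac{|\varphi|}{2}+1\right)^{2^{3|\varphi|}}+1 .$$ -/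

import Mathlib

namespace MPNL

/-- Formulae of Metric Propositional Neighborhood Logic over the atomic propositions `AP`. -/
inductive Formula (AP : Type*) where
  /-- the length constraint `len_{<k}` -/
  | lenLT (k : ℕ) : Formula AP
  | atom (p : AP) : Formula AP
  | neg (α : Formula AP) : Formula AP
  | or (α β : Formula AP) : Formula AP
  /-- `◇_l` -/
  | diaL (α : Formula AP) : Formula AP
  /-- `◇_r` -/
  | diaR (α : Formula AP) : Formula AP

namespace Formula

variable {AP : Type*}

/-- The length `|φ|`: the number of symbols of `φ`, every metric parameter `k` being written in
binary (`Nat.size k` is the number of binary digits of `k > 0`; the numeral of `0` has one). -/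
def length : Formula AP → ℕ
  | lenLT k => 1 + max 1 (Nat.size k)
  | atom _ => 1
  | neg α => α.length + 1
  | or α β => α.length + β.length + 1
  | diaL α => α.length + 1
  | diaR α => α.length + 1

/-- `k_φ`: the greatest metric parameter occurring in `φ`, and `0` if there is none. -/
def maxParam : Formula AP → ℕ
  | lenLT k => k
  | atom _ => 0
  | neg α => α.maxParam
  | or α β => max α.maxParam β.maxParam
  | diaL α => α.maxParam
  | diaR α => α.maxParam

/-- The set of subformulae of a formula (the formula itself included). -/
def subformulae : Formula AP → Set (Formula AP)
  | lenLT k => {lenLT k}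
  | atom p => {atom p}
  | neg α => insert (neg α) α.subformulae
  | or α β => insert (or α β) (α.subformulae ∪ β.subformulae)
  | diaL α => insert (diaL α) α.subformulae
  | diaR α => insert (diaR α) α.subformulae

/-- The negation of a formula, where the negation of `¬ α` is `α`. -/
def compl : Formula AP → Formula AP
  | neg α => α
  | lenLT k => neg (lenLT k)
  | atom p => neg (atom p)
  | or α β => neg (or α β)
  | diaL α => neg (diaL α)
  | diaR α => neg (diaR α)

/-- The closure `Cl(φ)`: all subformulae of `φ` and their negations. -/
def closure (φ : Formula AP) : Set (Formula AP) :=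
  φ.subformulae ∪ compl '' φ.subformulae

/-- `φ`-atoms. -/
structure IsAtom (φ : Formula AP) (F : Set (Formula AP)) : Prop where
  nonempty : F.Nonempty
  subset_closure : F ⊆ φ.closure
  neg_iff : ∀ α ∈ φ.closure, α ∈ F ↔ α.compl ∉ F
  or_iff : ∀ α β, or α β ∈ φ.closure → (or α β ∈ F ↔ α ∈ F ∨ β ∈ F)
  len_mono : ∀ k k', lenLT k ∈ φ.closure → lenLT k' ∈ φ.closure → k < k' →
    lenLT k ∈ F → lenLT k' ∈ F

/-- Future observables of `F`. -/
def obsR (φ : Formula AP) (F : Set (Formula AP)) : Set (Formula AP) :=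
  {ψ | ψ ∈ F ∧ diaR ψ ∈ φ.closure}

/-- Past observables of `F`. -/
def obsL (φ : Formula AP) (F : Set (Formula AP)) : Set (Formula AP) :=
  {ψ | ψ ∈ F ∧ diaL ψ ∈ φ.closure}

/-- `◇_r`-requests of `F`. -/
def reqR (φ : Formula AP) (F : Set (Formula AP)) : Set (Formula AP) :=
  {ψ | ψ ∈ φ.closure ∧ diaR ψ ∈ F}

/-- `◇_l`-requests of `F`. -/
def reqL (φ : Formula AP) (F : Set (Formula AP)) : Set (Formula AP) :=
  {ψ | ψ ∈ φ.closure ∧ diaL ψ ∈ F}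

/-- The dependency relation between two atoms. -/
def Dep (φ : Formula AP) (F G : Set (Formula AP)) : Prop :=
  φ.obsR G ⊆ φ.reqR F ∧ φ.obsL F ⊆ φ.reqL G

end Formula

/-- A finite compass `φ`-structure. Its domain `D` is the prefix `{0, …, yMax}` of `ℕ`, and its
points are the pairs `(x, y)` with `x ≤ y ≤ yMax`. Only the values of `label` at points matter. -/
structure FinCompass {AP : Type*} (φ : Formula AP) where
  yMax : ℕ
  label : ℕ → ℕ → Set (Formula AP)
  isAtom : ∀ x y, x ≤ y → y ≤ yMax → φ.IsAtom (label x y)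
  temporal : ∀ x y z, x ≤ y → y ≤ z → z ≤ yMax → φ.Dep (label x y) (label y z)
  lengthConsistent : ∀ x y, x ≤ y → y ≤ yMax →
    ∀ k, Formula.lenLT k ∈ label x y → y - x < k

namespace FinCompass

variable {AP : Type*} {φ : Formula AP} (G : FinCompass φ)

/-- The domain `D`. -/
def domain : Set ℕ := Set.Iic G.yMax

/-- `G` features `ψ`. -/
def Features (ψ : Formula AP) : Prop :=
  ∃ x y, x ≤ y ∧ y ≤ G.yMax ∧ ψ ∈ G.label x y

/-- All `◇_l`-requests of every point are fulfilled. -/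
def FulfillsL : Prop :=
  ∀ x y, x ≤ y → y ≤ G.yMax → ∀ ψ ∈ φ.reqL (G.label x y), ∃ z, z ≤ x ∧ ψ ∈ G.label z x

/-- The set of `◇_r`-requests of `(x, x)` still pending at `(x, y)`. -/
def pending (x y : ℕ) : Set (Formula AP) :=
  {ψ | ψ ∈ φ.reqR (G.label x x) ∧ ∀ y', x ≤ y' → y' ≤ y → ψ ∉ G.label x y'}

/-- The marking function. -/
def marking (x y : ℕ) : Set (Formula AP) × Set (Formula AP) × ℕ :=
  (G.label x y, G.pending x y, if y - x < φ.maxParam then y - x else φ.maxParam)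

/-- The marked atoms: the image of the marking function on the points of `G`. -/
def markedAtoms : Set (Set (Formula AP) × Set (Formula AP) × ℕ) :=
  {t | ∃ x y, x ≤ y ∧ y ≤ G.yMax ∧ G.marking x y = t}

/-- The horizontal configuration of the row `y`. -/
noncomputable def config (y : ℕ) (t : Set (Formula AP) × Set (Formula AP) × ℕ) : ℕ∞ :=
  Set.encard {x | x ≤ y ∧ G.marking x y = t}

/-- `G` is an `ℕ`-compass generator for `φ`. -/
structure IsNatGenerator : Prop where
  features : G.Features φ
  fulfillsL : G.FulfillsL
  exists_inf : ∃ yInf ∈ G.domain, yInf + φ.maxParam ≤ G.yMax ∧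
    (∀ t ∈ G.markedAtoms, 0 < G.config G.yMax t → 0 < G.config yInf t) ∧
    (∀ x, x ≤ yInf → ∃ F h, G.marking x G.yMax = (F, ∅, h))

end FinCompass

end MPNL

/-! ### Closures, and how the length pays for subformulae, modal arguments and the metric parameter
-/

namespace MPNL.Formula

variable {AP : Type*}

/-! A generator with the least `yMax` satisfies the bound, because one with too many rows can be
contracted. Classify the columns crossing a row by the label there, the distance from the diagonal
up to `k_φ`, and the status of each future observable. By pigeonhole (`exists_rowEquiv`) two rows
`y` and `y + δ` have equal class counts up to a threshold. The block between them is cut out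
(`Contraction`), and above the cut every surviving column imitates columns of its own class.
Imitation may switch column from row to row: consistency relates `(x, w)` only to points of column
`w`, so it survives if the classes fix left requests and the observables of a whole column. It
remains that each column still meets what it has not yet seen, and that each row keeps its past
observables; `exists_reallocation` achieves both with few columns per class. Up to `yInf`, columns
of all marked atoms on row `yInf` are tracked as well (`exists_shrink_low`); from `yInf + k_φ` on,
only the column featuring `φ` is (`exists_shrink_high`). The two pigeonhole bounds and the gap `k_φ`
add up to the estimate of `row_bound_le`. -/

theorem finite_subformulae (φ : Formula AP) : φ.subformulae.Finite := by
  induction φ with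
  | lenLT k => exact Set.finite_singleton _
  | atom p => exact Set.finite_singleton _
  | neg α ih => exact ih.insert _
  | or α β iha ihb => exact (iha.union ihb).insert _
  | diaL α ih => exact ih.insert _
  | diaR α ih => exact ih.insert _

theorem self_mem_subformulae (φ : Formula AP) : φ ∈ φ.subformulae := by
  cases φ <;> simp [subformulae]

theorem mem_subformulae_of_neg {φ α : Formula AP} (h : neg α ∈ φ.subformulae) :
    α ∈ φ.subformulae := by
  induction φ with
  | lenLT k => simp [subformulae] at h
  | atom p => simp [subformulae] at h
  | neg β ih =>
    rcases h with h | h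
    · cases h
      exact Or.inr (self_mem_subformulae _)
    · exact Or.inr (ih h)
  | or β γ ihb ihc =>
    rcases h with h | h | h
    · cases h
    · exact Or.inr (Or.inl (ihb h))
    · exact Or.inr (Or.inr (ihc h))
  | diaL β ih =>
    rcases h with h | h
    · cases h
    · exact Or.inr (ih h)
  | diaR β ih =>
    rcases h with h | h
    · cases h
    · exact Or.inr (ih h)

theorem diaR_mem_closure_iff {φ ψ : Formula AP} :
    diaR ψ ∈ φ.closure ↔ diaR ψ ∈ φ.subformulae := by
  refine ⟨?_, Or.inl⟩
  rintro (h | ⟨α, hα, h⟩)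
  · exact h
  · cases α <;> simp only [compl, reduceCtorEq] at h
    subst h
    exact mem_subformulae_of_neg hα

theorem diaL_mem_closure_iff {φ ψ : Formula AP} :
    diaL ψ ∈ φ.closure ↔ diaL ψ ∈ φ.subformulae := by
  refine ⟨?_, Or.inl⟩
  rintro (h | ⟨α, hα, h⟩)
  · exact h
  · cases α <;> simp only [compl, reduceCtorEq] at h
    subst h
    exact mem_subformulae_of_neg hα

theorem lenLT_mem_closure_iff {φ : Formula AP} {k : ℕ} :
    lenLT k ∈ φ.closure ↔ lenLT k ∈ φ.subformulae := by
  refine ⟨?_, Or.inl⟩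
  rintro (h | ⟨α, hα, h⟩)
  · exact h
  · cases α <;> simp only [compl, reduceCtorEq] at h
    subst h
    exact mem_subformulae_of_neg hα

theorem le_maxParam {φ : Formula AP} {k : ℕ} (h : lenLT k ∈ φ.closure) : k ≤ φ.maxParam := by
  rw [lenLT_mem_closure_iff] at h
  induction φ with
  | lenLT j => simp [subformulae] at h; simp [maxParam, h]
  | atom p => simp [subformulae] at h
  | neg β ih => simpa [maxParam] using ih (by simpa [subformulae] using h)
  | or β γ ihb ihc =>
    rcases h with h | h | h
    · cases h
    · exact (ihb h).trans (le_max_left _ _)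
    · exact (ihc h).trans (le_max_right _ _)
  | diaL β ih => simpa [maxParam] using ih (by simpa [subformulae] using h)
  | diaR β ih => simpa [maxParam] using ih (by simpa [subformulae] using h)

/-- Each node yields at most one new subformula and costs one symbol; the digits of the numerals are
extra and pay for the largest parameter. -/
theorem ncard_subformulae_add_size_le (φ : Formula AP) :
    φ.subformulae.ncard + Nat.size φ.maxParam ≤ φ.length := by
  induction φ with
  | lenLT k => simp [subformulae, maxParam, length]
  | atom p => simp [subformulae, maxParam, length]
  | neg α ih =>
    have := Set.ncard_insert_le (neg α) α.subformulae
    simp only [subformulae, maxParam, length]; omega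
  | diaL α ih =>
    have := Set.ncard_insert_le (diaL α) α.subformulae
    simp only [subformulae, maxParam, length]; omega
  | diaR α ih =>
    have := Set.ncard_insert_le (diaR α) α.subformulae
    simp only [subformulae, maxParam, length]; omega
  | or α β iha ihb =>
    have h1 := Set.ncard_insert_le (or α β) (α.subformulae ∪ β.subformulae)
    have h2 := Set.ncard_union_le α.subformulae β.subformulae
    have h3 : Nat.size (max α.maxParam β.maxParam) ≤
        Nat.size α.maxParam + Nat.size β.maxParam := by
      rcases max_choice α.maxParam β.maxParam with h | h <;> rw [h] <;> omega
    simp only [subformulae, maxParam, length]; omega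

/-- The formulae `ψ` such that `◇_r ψ` belongs to the closure. -/
def futureArgs (φ : Formula AP) : Set (Formula AP) := {ψ | diaR ψ ∈ φ.closure}

/-- The formulae `ψ` such that `◇_l ψ` belongs to the closure. -/
def pastArgs (φ : Formula AP) : Set (Formula AP) := {ψ | diaL ψ ∈ φ.closure}

theorem futureArgs_eq (φ : Formula AP) :
    φ.futureArgs = {ψ | diaR ψ ∈ φ.subformulae} := by
  ext ψ; exact diaR_mem_closure_iff

theorem pastArgs_eq (φ : Formula AP) :
    φ.pastArgs = {ψ | diaL ψ ∈ φ.subformulae} := by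
  ext ψ; exact diaL_mem_closure_iff

theorem finite_futureArgs (φ : Formula AP) : φ.futureArgs.Finite := by
  rw [futureArgs_eq]
  exact φ.finite_subformulae.preimage (f := diaR) (fun a _ b _ h => by simpa using h)

theorem finite_pastArgs (φ : Formula AP) : φ.pastArgs.Finite := by
  rw [pastArgs_eq]
  exact φ.finite_subformulae.preimage (f := diaL) (fun a _ b _ h => by simpa using h)

/-- Arguments are charged to diamonds. Strictness comes from the leaves, which cost a symbol and
carry no diamond. -/
theorem ncard_args_add_size_lt (φ : Formula AP) :
    φ.futureArgs.ncard + φ.pastArgs.ncard + Nat.size φ.maxParam < φ.length := by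
  rw [futureArgs_eq, pastArgs_eq]
  induction φ with
  | lenLT k => simp [subformulae, maxParam, length]; omega
  | atom p => simp [subformulae, maxParam, length]
  | neg α ih =>
    simp only [subformulae, maxParam, length, Set.mem_insert_iff, reduceCtorEq, false_or]; omega
  | diaL α ih =>
    have h1 : {ψ | diaL ψ ∈ (diaL α).subformulae} = insert α {ψ | diaL ψ ∈ α.subformulae} := by
      ext; simp [subformulae]
    have h2 := Set.ncard_insert_le α {ψ | diaL ψ ∈ α.subformulae}
    rw [h1]
    simp only [subformulae, maxParam, length, Set.mem_insert_iff, reduceCtorEq, false_or]; omega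
  | diaR α ih =>
    have h1 : {ψ | diaR ψ ∈ (diaR α).subformulae} = insert α {ψ | diaR ψ ∈ α.subformulae} := by
      ext; simp [subformulae]
    have h2 := Set.ncard_insert_le α {ψ | diaR ψ ∈ α.subformulae}
    rw [h1]
    simp only [subformulae, maxParam, length, Set.mem_insert_iff, reduceCtorEq, false_or]; omega
  | or α β iha ihb =>
    have h1 : {ψ | diaR ψ ∈ (or α β).subformulae} =
        {ψ | diaR ψ ∈ α.subformulae} ∪ {ψ | diaR ψ ∈ β.subformulae} := by
      ext; simp [subformulae]
    have h2 : {ψ | diaL ψ ∈ (or α β).subformulae} =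
        {ψ | diaL ψ ∈ α.subformulae} ∪ {ψ | diaL ψ ∈ β.subformulae} := by
      ext; simp [subformulae]
    have h3 := Set.ncard_union_le {ψ | diaR ψ ∈ α.subformulae} {ψ | diaR ψ ∈ β.subformulae}
    have h4 := Set.ncard_union_le {ψ | diaL ψ ∈ α.subformulae} {ψ | diaL ψ ∈ β.subformulae}
    have h5 : Nat.size (max α.maxParam β.maxParam) ≤
        Nat.size α.maxParam + Nat.size β.maxParam := by
      rcases max_choice α.maxParam β.maxParam with h | h <;> rw [h] <;> omega
    rw [h1, h2]
    simp only [maxParam, length]; omega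

/-- An atom is determined by its restriction to the subformulae. -/
theorem IsAtom.eq_of_inter_eq {φ : Formula AP} {F F' : Set (Formula AP)} (hF : φ.IsAtom F)
    (hF' : φ.IsAtom F') (h : ∀ α ∈ φ.subformulae, α ∈ F ↔ α ∈ F') : F = F' := by
  ext α
  by_cases hα : α ∈ φ.closure
  · rcases hα with hα | ⟨β, hβ, rfl⟩
    · exact h α hα
    · have h1 := hF.neg_iff β (Or.inl hβ)
      have h2 := hF'.neg_iff β (Or.inl hβ)
      have h3 := h β hβ
      tauto
  · exact ⟨fun h => (hα (hF.subset_closure h)).elim, fun h => (hα (hF'.subset_closure h)).elim⟩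

end MPNL.Formula

/-! ### Arithmetic of the bound -/

/-- The numerical estimate on the number of rows. -/
theorem row_bound_le {n s d m k σ : ℕ} (hk : k < 2 ^ σ) (hs : s + σ ≤ n)
    (hdm : d + m + σ < n) :
    ((2 * (2 ^ s * 3 ^ d * (k + 1) + m * (d + 1) + 3) ^ (2 ^ s * 3 ^ d * (k + 1)) + k +
      2 * (m * (d + 1) + 3) ^ (2 ^ s * 4 ^ d * (k + 1)) : ℕ) : ℝ) ≤
      ((2 : ℝ) ^ (3 * n) + 2) * ((n : ℝ) ^ 2 / 4 + (n : ℝ) / 2 + 1) ^ (2 ^ (3 * n)) + 1 := by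
  set b : ℝ := (n : ℝ) ^ 2 / 4 + (n : ℝ) / 2 + 1 with hb
  have hn : 1 ≤ n := by omega
  have hnR : (1 : ℝ) ≤ n := by exact_mod_cast hn
  have hb1 : 1 ≤ b := by rw [hb]; nlinarith
  have hpow : 2 ^ s * (k + 1) ≤ 2 ^ n :=
    calc 2 ^ s * (k + 1) ≤ 2 ^ s * 2 ^ σ := Nat.mul_le_mul_left _ hk
      _ = 2 ^ (s + σ) := (pow_add _ _ _).symm
      _ ≤ 2 ^ n := Nat.pow_le_pow_right (by norm_num) hs
  obtain ⟨p, rfl⟩ : ∃ p, n = p + 1 := ⟨n - 1, by omega⟩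
  have hT1 : 2 ^ s * 3 ^ d * (k + 1) ≤ 2 * 6 ^ p :=
    calc 2 ^ s * 3 ^ d * (k + 1) = 2 ^ s * (k + 1) * 3 ^ d := by ring
      _ ≤ 2 ^ (p + 1) * 3 ^ p :=
        Nat.mul_le_mul hpow (Nat.pow_le_pow_right (by norm_num) (by omega))
      _ = 2 * 6 ^ p := by rw [show 6 = 2 * 3 from rfl, mul_pow]; ring
  have hT2 : 2 ^ s * 4 ^ d * (k + 1) ≤ 2 * 8 ^ p :=
    calc 2 ^ s * 4 ^ d * (k + 1) = 2 ^ s * (k + 1) * 4 ^ d := by ring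
      _ ≤ 2 ^ (p + 1) * 4 ^ p :=
        Nat.mul_le_mul hpow (Nat.pow_le_pow_right (by norm_num) (by omega))
      _ = 2 * 8 ^ p := by rw [show 8 = 2 * 4 from rfl, mul_pow]; ring
  have hE : 2 ^ (3 * (p + 1)) = 8 * 8 ^ p := by
    rw [pow_mul, pow_succ]; norm_num; ring
  -- AM-GM: `m + (d + 1) ≤ n` gives a product of at most `n² / 4`.
  have hmd : (m : ℝ) * (d + 1) ≤ b - 1 := by
    have h1 : (d : ℝ) + m ≤ p := by exact_mod_cast (show d + m ≤ p by omega)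
    rw [hb]; push_cast
    nlinarith [sq_nonneg ((m : ℝ) - (d + 1)), Nat.cast_nonneg (α := ℝ) m,
      Nat.cast_nonneg (α := ℝ) d, Nat.cast_nonneg (α := ℝ) p]
  have hbp : (7 : ℝ) / 4 ≤ b := by rw [hb]; nlinarith
  have hb4 : b + 2 ≤ b ^ 4 := by nlinarith [sq_nonneg (b ^ 2 - 3), sq_nonneg (b - 7 / 4)]
  have hsix : (2 : ℝ) * 6 ^ p + b + 2 ≤ b ^ (p + 4) := by
    have key : (2 : ℝ) * 6 ^ p ≤ b ^ (p + 4) - b - 2 := by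
      rcases Nat.lt_or_ge p 3 with hp | hp
      · interval_cases p <;> norm_num [hb]
      · have hpR : (3 : ℝ) ≤ p := by exact_mod_cast hp
        have h7 : 7 ≤ b := by rw [hb]; push_cast; nlinarith
        have h6 : (6 : ℝ) ^ p ≤ b ^ p := pow_le_pow_left₀ (by norm_num) (by linarith) _
        have h1 : (1 : ℝ) ≤ 6 ^ p := one_le_pow₀ (by norm_num)
        rw [pow_add]
        have h2 : (6 : ℝ) ^ p * b ^ 4 ≤ b ^ p * b ^ 4 :=
          mul_le_mul_of_nonneg_right h6 (by positivity)
        have h3 : b + 4 ≤ b ^ 4 := by nlinarith [sq_nonneg (b ^ 2 - 3), sq_nonneg (b - 7 / 4)]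
        nlinarith
    linarith
  -- The base of the first power is only below `b ^ (p + 4)`; its smaller exponent, with `6 ^ p`
  -- instead of `8 ^ p`, absorbs the factor `p + 4`.
  have hexp1 : (p + 4) * (2 * 6 ^ p) ≤ 8 * 8 ^ p := by
    clear * -
    induction p with
    | zero => norm_num
    | succ p ih => rw [pow_succ, pow_succ]; nlinarith [show 0 < 6 ^ p by positivity]
  have hA : ((2 ^ s * 3 ^ d * (k + 1) + m * (d + 1) + 3 : ℕ) : ℝ) ^
      (2 ^ s * 3 ^ d * (k + 1)) ≤ b ^ (8 * 8 ^ p) := by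
    have h1 : ((2 ^ s * 3 ^ d * (k + 1) + m * (d + 1) + 3 : ℕ) : ℝ) ≤ b ^ (p + 4) := by
      have : ((2 ^ s * 3 ^ d * (k + 1) : ℕ) : ℝ) ≤ 2 * 6 ^ p := by exact_mod_cast hT1
      rw [Nat.cast_add, Nat.cast_add, Nat.cast_mul m]
      push_cast at this ⊢
      linarith
    calc _ ≤ (b ^ (p + 4)) ^ (2 ^ s * 3 ^ d * (k + 1)) :=
          pow_le_pow_left₀ (Nat.cast_nonneg _) h1 _
      _ = b ^ ((p + 4) * (2 ^ s * 3 ^ d * (k + 1))) := (pow_mul _ _ _).symm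
      _ ≤ _ := pow_le_pow_right₀ hb1 ((Nat.mul_le_mul_left _ hT1).trans hexp1)
  have hB : ((m * (d + 1) + 3 : ℕ) : ℝ) ^ (2 ^ s * 4 ^ d * (k + 1)) ≤ b ^ (8 * 8 ^ p) := by
    have h1 : ((m * (d + 1) + 3 : ℕ) : ℝ) ≤ b ^ 4 := by push_cast; linarith
    calc _ ≤ (b ^ 4) ^ (2 ^ s * 4 ^ d * (k + 1)) := pow_le_pow_left₀ (Nat.cast_nonneg _) h1 _
      _ = b ^ (4 * (2 ^ s * 4 ^ d * (k + 1))) := (pow_mul _ _ _).symm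
      _ ≤ _ := pow_le_pow_right₀ hb1 (by omega)
  have hB1 : 1 ≤ b ^ (8 * 8 ^ p) := one_le_pow₀ hb1
  have hk' : (k : ℝ) + 2 ≤ (2 : ℝ) ^ (3 * (p + 1)) := by
    have h1 : 2 ^ σ ≤ 2 ^ p := Nat.pow_le_pow_right (by norm_num) (by omega)
    have h2 : 2 ^ p ≤ 8 ^ p := Nat.pow_le_pow_left (by norm_num) _
    have h3 : k + 2 ≤ 2 ^ (3 * (p + 1)) := by rw [hE]; omega
    exact_mod_cast h3
  rw [hE]
  push_cast at hA hB ⊢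
  -- The left side is at most `4 * b ^ (8 * 8 ^ p) + k`, and `k + 2 ≤ 2 ^ (3 * (p + 1))`.
  nlinarith [mul_nonneg (show (0 : ℝ) ≤ 2 ^ (3 * (p + 1)) - 2 by linarith [Nat.cast_nonneg (α := ℝ) k])
    (show 0 ≤ b ^ (8 * 8 ^ p) - 1 by linarith)]

/-! ### Sharing the columns of one class -/

/-- Reallocation of columns. The columns in `X` are to imitate the columns in `U`, possibly
different ones on different rows, in such a way that all goals in `N` are met in every column, that
no goal in `Λ` gets lost on any row, and that every column in `V` has a faithful imitator. -/
theorem exists_reallocation {F : Type*} (P : ℕ → ℕ → F → Prop) (Z : Set ℕ) (X U V : Finset ℕ)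
    (Λ N : Finset F) (K : ℕ) (hK : Λ.card * (N.card + 1) + V.card + 1 ≤ K)
    (hcard : X.card = U.card ∨ K ≤ X.card ∧ K ≤ U.card)
    (hN : ∀ u ∈ U, ∀ ψ ∈ N, ∃ z ∈ Z, P u z ψ) :
    ∃ f : ℕ → ℕ → ℕ, (∀ z, ∀ x ∈ X, f z x ∈ U) ∧
      (∀ x ∈ X, ∀ ψ ∈ N, ∃ z ∈ Z, P (f z x) z ψ) ∧
      (∀ z, ∀ ψ ∈ Λ, ∀ u ∈ U, P u z ψ → ∃ x ∈ X, P (f z x) z ψ) ∧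
      (∀ v ∈ V, v ∈ U → ∃ x ∈ X, ∀ z, f z x = v) := by
  classical
  -- With equal counts a single bijection serves all rows; otherwise columns are plentiful and can
  -- be given roles.
  rcases hcard with hcard | ⟨hX, hU⟩
  · let e : X ≃ U := Finset.equivOfCardEq hcard
    refine ⟨fun _ x => if h : x ∈ X then e ⟨x, h⟩ else 0, ?_, ?_, ?_, ?_⟩
    · intro z x hx
      simp [hx]
    · intro x hx ψ hψ
      simpa [hx] using hN (e ⟨x, hx⟩) (e ⟨x, hx⟩).2 ψ hψ
    · intro z ψ _ u hu h
      refine ⟨e.symm ⟨u, hu⟩, (e.symm ⟨u, hu⟩).2, by simpa using h⟩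
    · intro v _ hv
      exact ⟨e.symm ⟨v, hv⟩, (e.symm ⟨v, hv⟩).2, by simp⟩
  · obtain ⟨u₀, hu₀⟩ : U.Nonempty := Finset.card_pos.1 (by omega)
    -- Roles: `Λ.card * (N.card + 1)` to keep `Λ`, one per tracked column, and a spare one making
    -- `Slot` nonempty.
    let Slot := (Λ × Option N) ⊕ Option V
    obtain ⟨r, hr⟩ : ∃ r : X → Slot, Function.Surjective r := by
      have hc : Fintype.card Slot ≤ Fintype.card X := by
        simp only [Slot, Fintype.card_sum, Fintype.card_prod, Fintype.card_option,
          Fintype.card_coe]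
        omega
      obtain ⟨i⟩ := Function.Embedding.nonempty_of_card_le hc
      have : Nonempty Slot := ⟨Sum.inr none⟩
      exact ⟨Function.invFun i, Function.invFun_surjective i.injective⟩
    choose! t htZ ht using hN u₀ hu₀
    let g : ℕ → F → ℕ := fun z ψ => if h : ∃ u ∈ U, P u z ψ then h.choose else u₀
    have hgU : ∀ z ψ, g z ψ ∈ U := by
      intro z ψ
      by_cases h : ∃ u ∈ U, P u z ψ
      · simp only [g, dif_pos h]; exact h.choose_spec.1
      · simp only [g, dif_neg h]; exact hu₀
    have hgP : ∀ z ψ, ∀ u ∈ U, P u z ψ → P (g z ψ) z ψ := by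
      intro z ψ u hu hP
      have h : ∃ u ∈ U, P u z ψ := ⟨u, hu, hP⟩
      simp only [g, dif_pos h]; exact h.choose_spec.2
    -- The role `(ψ, none)` supplies `ψ` on all rows except the `N.card` or fewer rows `t χ`, where
    -- it follows `u₀` and so meets all its goals. On row `t χ` the role `(ψ, some χ)` takes over;
    -- it follows one fixed column throughout, whose goals `hN` already meets.
    let a : ℕ → Slot → ℕ := fun z c => match c with
      | Sum.inl (ψ, none) => if z ∈ N.image t then u₀ else g z ψ
      | Sum.inl (ψ, some χ) => g (t χ) ψ
      | Sum.inr none => u₀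
      | Sum.inr (some v) => if v.1 ∈ U then v.1 else u₀
    have haU : ∀ z c, a z c ∈ U := by
      rintro z (⟨ψ, _ | χ⟩ | _ | v) <;> simp only [a]
      · split_ifs
        · exact hu₀
        · exact hgU _ _
      · exact hgU _ _
      · exact hu₀
      · split_ifs with h
        · exact h
        · exact hu₀
    have haN : ∀ c, ∀ ψ ∈ N, ∃ z ∈ Z, P (a z c) z ψ := by
      rintro (⟨χ, _ | χ'⟩ | _ | v) ψ hψ
      · refine ⟨t ψ, htZ ψ hψ, ?_⟩
        simp only [a, if_pos (Finset.mem_image_of_mem t hψ)]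
        exact ht ψ hψ
      · exact hN _ (haU 0 (Sum.inl (χ, some χ'))) ψ hψ
      · exact hN _ (haU 0 (Sum.inr none)) ψ hψ
      · exact hN _ (haU 0 (Sum.inr (some v))) ψ hψ
    refine ⟨fun z x => if h : x ∈ X then a z (r ⟨x, h⟩) else 0, ?_, ?_, ?_, ?_⟩
    · intro z x hx
      simpa [hx] using haU _ _
    · intro x hx ψ hψ
      simpa [hx] using haN (r ⟨x, hx⟩) ψ hψ
    · intro z ψ hψ u hu hP
      by_cases hz : z ∈ N.image t
      · obtain ⟨χ, hχ, rfl⟩ := Finset.mem_image.1 hz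
        obtain ⟨x, hx⟩ := hr (Sum.inl (⟨ψ, hψ⟩, some ⟨χ, hχ⟩))
        refine ⟨x, x.2, ?_⟩
        simpa [hx, a] using hgP _ _ u hu hP
      · obtain ⟨x, hx⟩ := hr (Sum.inl (⟨ψ, hψ⟩, none))
        refine ⟨x, x.2, ?_⟩
        have h := hgP _ _ u hu hP
        simpa only [Subtype.coe_eta, x.2, dite_true, hx, a, if_neg hz] using h
    · intro v hv hvU
      obtain ⟨x, hx⟩ := hr (Sum.inr (some ⟨v, hv⟩))
      exact ⟨x, x.2, fun z => by simp [hx, a, hvU]⟩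

/-! ### Cutting out a block of rows and columns -/

namespace MPNL.FinCompass

variable {AP : Type*} {φ : Formula AP} (G : FinCompass φ)

/-- The future observables seen at the points `(x, x), …, (x, y)` of the column `x`. -/
def seen (x y : ℕ) : Set (Formula AP) :=
  {ψ | ψ ∈ φ.futureArgs ∧ ∃ y', x ≤ y' ∧ y' ≤ y ∧ ψ ∈ G.label x y'}

/-- The point `(x, y)` looks like `(u, v)`, as to its label, the requests of its column, the
observables of its column, those already seen, and the distance from the diagonal. -/
structure SameState (x y u v : ℕ) : Prop where
  label : G.label x y = G.label u v
  req : φ.reqR (G.label x x) = φ.reqR (G.label u u)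
  all : G.seen x G.yMax = G.seen u G.yMax
  seen : G.seen x y = G.seen u v
  dist : min (y - x) φ.maxParam = min (v - u) φ.maxParam

variable {G}

theorem mem_futureArgs {x y : ℕ} {ψ : Formula AP} (hxy : x ≤ y) (hy : y ≤ G.yMax)
    (h : ψ ∈ φ.reqR (G.label x y)) : ψ ∈ φ.futureArgs :=
  (G.isAtom x y hxy hy).subset_closure h.2

theorem pending_eq {x y : ℕ} (hx : x ≤ G.yMax) :
    G.pending x y = φ.reqR (G.label x x) \ G.seen x y := by
  ext ψ
  constructor
  · rintro ⟨h1, h2⟩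
    exact ⟨h1, fun ⟨_, y', h3, h4, h5⟩ => h2 y' h3 h4 h5⟩
  · rintro ⟨h1, h2⟩
    exact ⟨h1, fun y' h3 h4 h5 => h2 ⟨mem_futureArgs le_rfl hx h1, y', h3, h4, h5⟩⟩

theorem marking_eq (x y : ℕ) :
    G.marking x y = (G.label x y, G.pending x y, min (y - x) φ.maxParam) := by
  unfold marking
  congr 2
  split_ifs <;> omega

theorem seen_subset_reqR {v x : ℕ} (hvx : v ≤ x) :
    G.seen x G.yMax ⊆ φ.reqR (G.label v x) := by
  rintro ψ ⟨h1, z, h2, h3, h4⟩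
  exact (G.temporal v x z hvx h2 h3).1 ⟨h4, h1⟩

theorem seen_mono {x y z : ℕ} (h : y ≤ z) : G.seen x y ⊆ G.seen x z :=
  fun _ ⟨h1, y', h2, h3, h4⟩ => ⟨h1, y', h2, h3.trans h, h4⟩

/-- The left requests are the same all along a column. -/
theorem FulfillsL.reqL_eq (hG : G.FulfillsL) {x y z : ℕ} (hxy : x ≤ y) (hy : y ≤ G.yMax)
    (hxz : x ≤ z) (hz : z ≤ G.yMax) : φ.reqL (G.label x y) = φ.reqL (G.label x z) := by
  have key : ∀ y z, x ≤ y → y ≤ G.yMax → x ≤ z → z ≤ G.yMax →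
      φ.reqL (G.label x y) ⊆ φ.reqL (G.label x z) := by
    intro y z hxy hy hxz hz ψ hψ
    -- A witness `(v, x)` precedes every point of column `x`, so it forces the request on all of
    -- them.
    obtain ⟨v, hv, hvψ⟩ := hG x y hxy hy ψ hψ
    exact (G.temporal v x z hv hxz hz).2
      ⟨hvψ, (G.isAtom x y hxy hy).subset_closure hψ.2⟩
  exact (key y z hxy hy hxz hz).antisymm (key z y hxz hz hxy hy)

variable (G)

/-- The data needed to remove the rows and columns `y + 1, …, y + δ`: on each later row `z` the
column `x ≤ y` is to imitate the column `f z x`. -/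
structure Contraction (y δ : ℕ) (f : ℕ → ℕ → ℕ) : Prop where
  fulfillsL : G.FulfillsL
  le_yMax : y + δ ≤ G.yMax
  le : ∀ z x, x ≤ y → f z x ≤ y + δ
  sameState : ∀ z x, x ≤ y → G.SameState x y (f z x) (y + δ)
  meets : ∀ x ≤ y, ∀ ψ ∈ G.seen x G.yMax \ G.seen x y,
    ∃ z, y + δ < z ∧ z ≤ G.yMax ∧ ψ ∈ G.label (f z x) z
  keeps : ∀ z, ∀ ψ ∈ φ.pastArgs, ∀ u ≤ y + δ, ψ ∈ G.label u z →
    ∃ x ≤ y, ψ ∈ G.label (f z x) z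

/-- The labelling after removal of the rows and columns `y + 1, …, y + δ`. -/
def contractLabel (y δ : ℕ) (f : ℕ → ℕ → ℕ) (x z : ℕ) : Set (Formula AP) :=
  if z ≤ y then G.label x z
  else if x ≤ y then G.label (f (z + δ) x) (z + δ)
  else G.label (x + δ) (z + δ)

variable {G} {y δ : ℕ} {f : ℕ → ℕ → ℕ}

theorem contractLabel_low {x z : ℕ} (hz : z ≤ y) :
    G.contractLabel y δ f x z = G.label x z := by
  simp [contractLabel, hz]

theorem contractLabel_mid {x z : ℕ} (hx : x ≤ y) (hz : y < z) :
    G.contractLabel y δ f x z = G.label (f (z + δ) x) (z + δ) := by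
  simp [contractLabel, hx, hz.not_ge]

theorem contractLabel_high {x z : ℕ} (hx : y < x) (hz : y < z) :
    G.contractLabel y δ f x z = G.label (x + δ) (z + δ) := by
  simp [contractLabel, hx.not_ge, hz.not_ge]

namespace Contraction

theorem min_dist_eq (h : G.Contraction y δ f) {x z : ℕ} (hx : x ≤ y) (hz : y < z) :
    min (z - x) φ.maxParam = min (z + δ - f (z + δ) x) φ.maxParam := by
  have h1 := (h.sameState (z + δ) x hx).dist
  have h2 := h.le (z + δ) x hx
  omega

theorem reqL_mid (h : G.Contraction y δ f) {x z : ℕ} (hx : x ≤ y) (hz : y < z)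
    (hz' : z + δ ≤ G.yMax) :
    φ.reqL (G.label (f (z + δ) x) (z + δ)) = φ.reqL (G.label x y) := by
  have h1 := h.le (z + δ) x hx
  rw [(h.sameState (z + δ) x hx).label]
  exact h.fulfillsL.reqL_eq (by omega) hz' h1 h.le_yMax

/-- The compass structure after removal of the rows and columns `y + 1, …, y + δ`. -/
def toFinCompass (h : G.Contraction y δ f) : FinCompass φ where
  yMax := G.yMax - δ
  label := G.contractLabel y δ f
  isAtom x z hxz hz := by
    have hM := h.le_yMax
    rcases le_or_gt z y with hzy | hzy
    · rw [contractLabel_low hzy]; exact G.isAtom x z hxz (by omega)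
    · rcases le_or_gt x y with hxy | hxy
      · rw [contractLabel_mid hxy hzy]
        have := h.le (z + δ) x hxy
        exact G.isAtom _ _ (by omega) (by omega)
      · rw [contractLabel_high hxy hzy]; exact G.isAtom _ _ (by omega) (by omega)
  temporal x w z hxw hwz hz := by
    have hM := h.le_yMax
    rcases le_or_gt z y with hzy | hzy
    · rw [contractLabel_low hzy, contractLabel_low (hwz.trans hzy)]
      exact G.temporal x w z hxw hwz (by omega)
    · rcases le_or_gt w y with hwy | hwy
      · rw [contractLabel_low hwy, contractLabel_mid hwy hzy]
        have hu := h.le (z + δ) w hwy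
        constructor
        -- The imitated column shows in total the same observables as column `w`, and those were all
        -- requested at `(x, w)`.
        · rintro ψ ⟨h1, h2⟩
          refine seen_subset_reqR hxw ?_
          rw [(h.sameState (z + δ) w hwy).all]
          exact ⟨h2, z + δ, by omega, by omega, h1⟩
        · rw [h.reqL_mid hwy hzy (by omega)]
          exact (G.temporal x w y hxw hwy (by omega)).2
      · rw [contractLabel_high hwy hzy]
        rcases le_or_gt x y with hxy | hxy
        · rw [contractLabel_mid hxy hwy]
          have := h.le (w + δ) x hxy
          exact G.temporal _ _ _ (by omega) (by omega) (by omega)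
        · rw [contractLabel_high hxy hwy]
          exact G.temporal _ _ _ (by omega) (by omega) (by omega)
  lengthConsistent x z hxz hz j hj := by
    have hM := h.le_yMax
    rcases le_or_gt z y with hzy | hzy
    · rw [contractLabel_low hzy] at hj
      exact G.lengthConsistent x z hxz (by omega) j hj
    · rcases le_or_gt x y with hxy | hxy
      · rw [contractLabel_mid hxy hzy] at hj
        have h1 := h.le (z + δ) x hxy
        have h2 := G.lengthConsistent _ _ (by omega) (by omega) j hj
        -- Lengths are preserved only up to `k_φ`, which suffices as `j ≤ k_φ`.
        have h3 := Formula.le_maxParam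
          ((G.isAtom (f (z + δ) x) (z + δ) (by omega) (by omega)).subset_closure hj)
        have h4 := h.min_dist_eq hxy hzy
        omega
      · rw [contractLabel_high hxy hzy] at hj
        have := G.lengthConsistent _ _ (by omega) (by omega) j hj
        omega

variable (h : G.Contraction y δ f)

theorem label_low {x z : ℕ} (hz : z ≤ y) : h.toFinCompass.label x z = G.label x z :=
  contractLabel_low hz

theorem label_mid {x z : ℕ} (hx : x ≤ y) (hz : y < z) :
    h.toFinCompass.label x z = G.label (f (z + δ) x) (z + δ) :=
  contractLabel_mid hx hz

theorem label_high {x z : ℕ} (hx : y < x) (hz : y < z) :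
    h.toFinCompass.label x z = G.label (x + δ) (z + δ) :=
  contractLabel_high hx hz

theorem yMax_eq : h.toFinCompass.yMax = G.yMax - δ := rfl

theorem fulfillsL_toFinCompass : h.toFinCompass.FulfillsL := by
  intro x z hxz hz ψ hψ
  have hM := h.le_yMax
  rw [h.yMax_eq] at hz
  rcases le_or_gt x y with hxy | hxy
  · have h1 : ∃ z', x ≤ z' ∧ z' ≤ G.yMax ∧ ψ ∈ φ.reqL (G.label x z') := by
      rcases le_or_gt z y with hzy | hzy
      · rw [h.label_low hzy] at hψ
        exact ⟨z, hxz, by omega, hψ⟩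
      · rw [h.label_mid hxy hzy, h.reqL_mid hxy hzy (by omega)] at hψ
        exact ⟨y, hxy, by omega, hψ⟩
    obtain ⟨z', h2, h3, h4⟩ := h1
    obtain ⟨v, hv, hvψ⟩ := h.fulfillsL x z' h2 h3 ψ h4
    exact ⟨v, hv, by rwa [h.label_low hxy]⟩
  · rw [h.label_high hxy (by omega)] at hψ
    obtain ⟨v, hv, hvψ⟩ := h.fulfillsL _ _ (by omega) (by omega) ψ hψ
    rcases le_or_gt v (y + δ) with hvy | hvy
    -- The old witness may be removed or relabelled; some surviving column still carries `ψ` on this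
    -- row.
    · obtain ⟨w, hw, hwψ⟩ := h.keeps (x + δ) ψ
        ((G.isAtom _ _ (by omega) (by omega)).subset_closure hψ.2) v hvy hvψ
      exact ⟨w, by omega, by rwa [h.label_mid hw hxy]⟩
    · refine ⟨v - δ, by omega, ?_⟩
      rw [h.label_high (by omega) hxy, Nat.sub_add_cancel (by omega)]
      exact hvψ

theorem seen_low {x z : ℕ} (hz : z ≤ y) : h.toFinCompass.seen x z = G.seen x z := by
  ext ψ
  simp only [FinCompass.seen, Set.mem_ofPred_eq]
  refine and_congr_right fun _ => exists_congr fun z' => and_congr_right fun _ =>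
    and_congr_right fun h1 => ?_
  rw [h.label_low (h1.trans hz)]

theorem pending_low {x z : ℕ} (hxz : x ≤ z) (hz : z ≤ y) :
    h.toFinCompass.pending x z = G.pending x z := by
  have hM := h.le_yMax
  rw [FinCompass.pending_eq (by rw [h.yMax_eq]; omega), FinCompass.pending_eq (by omega),
    h.seen_low hz, h.label_low (hxz.trans hz)]

theorem marking_low {x z : ℕ} (hxz : x ≤ z) (hz : z ≤ y) :
    h.toFinCompass.marking x z = G.marking x z := by
  rw [marking_eq, marking_eq, h.pending_low hxz hz, h.label_low hz]

theorem seen_high {x z : ℕ} (hx : y < x) :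
    h.toFinCompass.seen x z = G.seen (x + δ) (z + δ) := by
  ext ψ
  refine and_congr_right fun _ => ⟨?_, ?_⟩
  · rintro ⟨z', h1, h2, h3⟩
    rw [h.label_high hx (by omega)] at h3
    exact ⟨z' + δ, by omega, by omega, h3⟩
  · rintro ⟨z', h1, h2, h3⟩
    refine ⟨z' - δ, by omega, by omega, ?_⟩
    rwa [h.label_high hx (by omega), Nat.sub_add_cancel (by omega)]

theorem marking_high {x z : ℕ} (hx : y < x) (hxz : x ≤ z) (hz : z + δ ≤ G.yMax) :
    h.toFinCompass.marking x z = G.marking (x + δ) (z + δ) := by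
  rw [marking_eq, marking_eq, FinCompass.pending_eq (by rw [h.yMax_eq]; omega),
    FinCompass.pending_eq (by omega), h.seen_high hx, h.label_high hx (by omega),
    h.label_high hx (by omega)]
  congr 3
  omega

theorem seen_mid {x z : ℕ} (hx : x ≤ y) (hz : y < z) {ψ : Formula AP} :
    ψ ∈ h.toFinCompass.seen x z ↔ ψ ∈ G.seen x y ∨
      ψ ∈ φ.futureArgs ∧ ∃ z', y + δ < z' ∧ z' ≤ z + δ ∧ ψ ∈ G.label (f z' x) z' := by
  constructor
  · rintro ⟨h1, z', h2, h3, h4⟩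
    rcases le_or_gt z' y with hzy | hzy
    · rw [h.label_low hzy] at h4
      exact Or.inl ⟨h1, z', h2, hzy, h4⟩
    · rw [h.label_mid hx hzy] at h4
      exact Or.inr ⟨h1, z' + δ, by omega, by omega, h4⟩
  · rintro (⟨h1, z', h2, h3, h4⟩ | ⟨h1, z', h2, h3, h4⟩)
    · exact ⟨h1, z', h2, by omega, by rwa [h.label_low h3]⟩
    · refine ⟨h1, z' - δ, by omega, by omega, ?_⟩
      rwa [h.label_mid hx (by omega), Nat.sub_add_cancel (by omega)]

theorem seen_yMax {x : ℕ} (hx : x ≤ y) :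
    h.toFinCompass.seen x (G.yMax - δ) = G.seen x G.yMax := by
  have hM := h.le_yMax
  rcases hM.lt_or_eq with hlt | heq
  · ext ψ
    rw [h.seen_mid hx (by omega), Nat.sub_add_cancel (by omega)]
    constructor
    · rintro (h1 | ⟨h1, z', h2, h3, h4⟩)
      · exact seen_mono (by omega) h1
      · rw [(h.sameState z' x hx).all]
        exact ⟨h1, z', by have := h.le z' x hx; omega, h3, h4⟩
    · intro h1
      by_cases h2 : ψ ∈ G.seen x y
      · exact Or.inl h2
      · exact Or.inr ⟨h1.1, h.meets x hx ψ ⟨h1, h2⟩⟩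
  · have h1 : G.yMax - δ = y := by omega
    -- No rows lie above the cut. The row `0` is arbitrary: the imitated column is in the same state
    -- whatever the row.
    rw [h1, h.seen_low le_rfl, (h.sameState 0 x hx).seen, heq, (h.sameState 0 x hx).all]

theorem pending_yMax {x : ℕ} (hx : x ≤ y) :
    h.toFinCompass.pending x (G.yMax - δ) = G.pending x G.yMax := by
  have hM := h.le_yMax
  rw [FinCompass.pending_eq (by rw [h.yMax_eq]; omega), FinCompass.pending_eq (by omega),
    h.seen_yMax hx, h.label_low hx]

/-- Switching columns can disturb pending sets on intermediate rows, but on the top row they depend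
only on the requests and all observables of the column, which imitation preserves. -/
theorem exists_marking_yMax {x : ℕ} (hx : x ≤ y) :
    ∃ u ≤ y + δ, h.toFinCompass.marking x (G.yMax - δ) = G.marking u G.yMax := by
  have hM := h.le_yMax
  refine ⟨f G.yMax x, h.le _ x hx, ?_⟩
  have hs := h.sameState G.yMax x hx
  have hu := h.le G.yMax x hx
  rw [marking_eq, marking_eq, h.pending_yMax hx, FinCompass.pending_eq (by omega),
    FinCompass.pending_eq (by omega), hs.all, hs.req]
  rcases hM.lt_or_eq with hlt | heq
  · have h1 := h.min_dist_eq hx (z := G.yMax - δ) (by omega)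
    have h2 : G.yMax - δ + δ = G.yMax := by omega
    rw [h.label_mid hx (by omega), h2, h1, h2]
  · have h1 : G.yMax - δ = y := by omega
    rw [h1, h.label_low le_rfl, hs.label, hs.dist, heq]

/-- A column that never switches copies pending sets on every row; tracked columns rely on this at
row `yInf`. -/
theorem marking_follow {x z v : ℕ} (hf : ∀ z, f z x = v) (hx : x ≤ y) (hz : y < z)
    (hz' : z + δ ≤ G.yMax) : h.toFinCompass.marking x z = G.marking v (z + δ) := by
  have hs := h.sameState (z + δ) x hx
  have hv := h.le (z + δ) x hx
  have hd := h.min_dist_eq hx hz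
  rw [hf] at hs hv hd
  rw [marking_eq, marking_eq, h.label_mid hx hz, hf, hd, FinCompass.pending_eq
    (by rw [h.yMax_eq]; omega), FinCompass.pending_eq (by omega), h.label_low hx, hs.req]
  congr 3
  ext ψ
  rw [h.seen_mid hx hz, hs.seen]
  constructor
  · rintro (h1 | ⟨h1, z', h2, h3, h4⟩)
    · exact seen_mono (by omega) h1
    · exact ⟨h1, z', by omega, h3, by rwa [hf] at h4⟩
  · rintro ⟨h1, z', h2, h3, h4⟩
    rcases le_or_gt z' (y + δ) with h5 | h5
    · exact Or.inl ⟨h1, z', h2, h5, h4⟩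
    · exact Or.inr ⟨h1, z', h5, h3, by rwa [hf]⟩

theorem features_toFinCompass {x₀ y₀ : ℕ} (hxy : x₀ ≤ y₀) (hy : y₀ ≤ G.yMax) {χ : Formula AP}
    (hχ : χ ∈ G.label x₀ y₀) (hrow : y₀ ≤ y ∨ y + δ < y₀)
    (hf : x₀ ≤ y + δ → ∃ x ≤ y, ∀ z, f z x = x₀) : h.toFinCompass.Features χ := by
  have hM := h.le_yMax
  rcases hrow with hrow | hrow
  · exact ⟨x₀, y₀, hxy, by rw [h.yMax_eq]; omega, by rwa [h.label_low hrow]⟩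
  · have h1 : y₀ - δ + δ = y₀ := by omega
    rcases le_or_gt x₀ (y + δ) with hx | hx
    · obtain ⟨x, hxy', hfx⟩ := hf hx
      refine ⟨x, y₀ - δ, by omega, by rw [h.yMax_eq]; omega, ?_⟩
      rwa [h.label_mid hxy' (by omega), h1, hfx]
    · refine ⟨x₀ - δ, y₀ - δ, by omega, by rw [h.yMax_eq]; omega, ?_⟩
      rwa [h.label_high (by omega) (by omega), h1, Nat.sub_add_cancel (by omega)]

end Contraction

end MPNL.FinCompass

/-! ### Column classes, pigeonhole and shrinking -/

namespace MPNL.FinCompass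

variable {AP : Type*} {φ : Formula AP} {G : FinCompass φ}

theorem SameState.marking_eq {x y u v : ℕ} (h : G.SameState x y u v) (hx : x ≤ G.yMax)
    (hu : u ≤ G.yMax) : G.marking x y = G.marking u v := by
  rw [FinCompass.marking_eq, FinCompass.marking_eq, pending_eq hx, pending_eq hu, h.label, h.req,
    h.seen, h.dist]

theorem isNatGenerator_iff : G.IsNatGenerator ↔ G.Features φ ∧ G.FulfillsL ∧
    ∃ yInf, yInf + φ.maxParam ≤ G.yMax ∧
      (∀ x ≤ G.yMax, ∃ x' ≤ yInf, G.marking x' yInf = G.marking x G.yMax) ∧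
      ∀ x ≤ yInf, G.pending x G.yMax = ∅ := by
  constructor
  · rintro ⟨h1, h2, yInf, _, h4, h5, h6⟩
    refine ⟨h1, h2, yInf, h4, fun x hx => ?_, fun x hx => ?_⟩
    · have := h5 (G.marking x G.yMax) ⟨x, G.yMax, hx, le_rfl, rfl⟩
        (Set.encard_pos.2 ⟨x, hx, rfl⟩)
      exact Set.encard_pos.1 this
    · obtain ⟨F, h, hF⟩ := h6 x hx
      exact congrArg (fun t => t.2.1) hF
  · rintro ⟨h1, h2, yInf, h4, h5, h6⟩
    refine ⟨h1, h2, yInf, ?_, h4, ?_, ?_⟩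
    · exact Set.mem_Iic.2 (by omega)
    · rintro t - ht
      obtain ⟨x, hx, rfl⟩ := Set.encard_pos.1 ht
      exact Set.encard_pos.2 (h5 x hx)
    · intro x hx
      exact ⟨G.label x G.yMax, min (G.yMax - x) φ.maxParam, by rw [marking_eq, h6 x hx]⟩

open Classical in
/-- The number of columns of class `c` on the row `y`. -/
noncomputable def classColumns {C : Type*} (κ : ℕ → ℕ → C) (y : ℕ) (c : C) : Finset ℕ :=
  (Finset.range (y + 1)).filter (fun x => κ x y = c)

theorem mem_classColumns {C : Type*} {κ : ℕ → ℕ → C} {y x : ℕ} {c : C} :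
    x ∈ classColumns κ y c ↔ x ≤ y ∧ κ x y = c := by
  simp [classColumns]

/-- Two rows have the same number of columns of every class, up to the threshold `K`. -/
def RowEquiv {C : Type*} (κ : ℕ → ℕ → C) (K y y' : ℕ) : Prop :=
  ∀ c, (classColumns κ y c).card = (classColumns κ y' c).card ∨
    K ≤ (classColumns κ y c).card ∧ K ≤ (classColumns κ y' c).card

/-- Counts truncated at `K` take `K + 1` values per class. The factor `2` puts both rows on the same
side of `y₀`, so that the row featuring `φ` is not cut out. -/
theorem exists_rowEquiv {C : Type*} [Finite C] (κ : ℕ → ℕ → C) (K y₀ : ℕ) (R : Finset ℕ)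
    (hR : 2 * (K + 1) ^ Nat.card C < R.card) :
    ∃ y ∈ R, ∃ y' ∈ R, y < y' ∧ (y₀ ≤ y ∨ y' < y₀) ∧ RowEquiv κ K y y' := by
  classical
  have := Fintype.ofFinite C
  let g : ℕ → Bool × (C → Fin (K + 1)) := fun y =>
    (decide (y₀ ≤ y), fun c => ⟨min (classColumns κ y c).card K, by omega⟩)
  have hc : (Finset.univ : Finset (Bool × (C → Fin (K + 1)))).card < R.card := by
    simpa [Nat.card_eq_fintype_card] using hR
  obtain ⟨y, hy, y', hy', hne, hg⟩ := Finset.exists_ne_map_eq_of_card_lt_of_maps_to hc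
    (f := g) (fun _ _ => Finset.mem_univ _)
  have key : ∀ y y', g y = g y' → y < y' → (y₀ ≤ y ∨ y' < y₀) ∧ RowEquiv κ K y y' := by
    intro y y' hg hlt
    obtain ⟨h1, h2⟩ := Prod.ext_iff.1 hg
    constructor
    · have : y₀ ≤ y ↔ y₀ ≤ y' := by simpa [g] using h1
      omega
    · intro c
      have h3 := congrArg Fin.val (congrFun h2 c)
      simp only [g] at h3
      omega
  rcases hne.lt_or_gt with h | h
  · exact ⟨y, hy, y', hy', h, key y y' hg h⟩
  · exact ⟨y', hy', y, hy, h, key y' y hg.symm h⟩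

theorem exists_contraction (hG : G.FulfillsL) {y δ : ℕ} (hy : y + δ ≤ G.yMax) {C : Type*}
    (κ : ℕ → ℕ → C)
    (hκ : ∀ x ≤ y, ∀ u ≤ y + δ, κ x y = κ u (y + δ) → G.SameState x y u (y + δ))
    (V : Finset ℕ) (K : ℕ)
    (hK : φ.pastArgs.ncard * (φ.futureArgs.ncard + 1) + V.card + 1 ≤ K)
    (hrow : RowEquiv κ K y (y + δ)) :
    ∃ f, G.Contraction y δ f ∧ ∀ v ∈ V, v ≤ y + δ → ∃ x ≤ y, ∀ z, f z x = v := by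
  classical
  let Λ := φ.finite_pastArgs.toFinset
  let Ψ := φ.finite_futureArgs.toFinset
  -- What is still to be seen depends only on the class, so the goals common to a class are those of
  -- each of its columns.
  let N : C → Finset (Formula AP) := fun c => Ψ.filter fun ψ =>
    ∀ u ∈ classColumns κ (y + δ) c, ψ ∈ G.seen u G.yMax \ G.seen u (y + δ)
  have hcard : ∀ c, Λ.card * ((N c).card + 1) + V.card + 1 ≤ K := by
    intro c
    have h1 : (N c).card ≤ φ.futureArgs.ncard := by
      rw [Set.ncard_eq_toFinset_card _ φ.finite_futureArgs]
      exact Finset.card_filter_le _ _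
    have h2 : Λ.card = φ.pastArgs.ncard := (Set.ncard_eq_toFinset_card _ _).symm
    rw [h2]
    have := Nat.mul_le_mul_left φ.pastArgs.ncard (Nat.add_le_add_right h1 1)
    omega
  have hN : ∀ c, ∀ u ∈ classColumns κ (y + δ) c, ∀ ψ ∈ N c,
      ∃ z ∈ {z | y + δ < z ∧ z ≤ G.yMax}, ψ ∈ G.label u z := by
    intro c u hu ψ hψ
    obtain ⟨⟨h1, z, h2, h3, h4⟩, h5⟩ := (Finset.mem_filter.1 hψ).2 u hu
    refine ⟨z, ⟨?_, h3⟩, h4⟩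
    by_contra h6
    exact h5 ⟨h1, z, h2, not_lt.1 h6, h4⟩
  choose f hfU hfN hfΛ hfV using fun c => exists_reallocation (fun u z ψ => ψ ∈ G.label u z)
    {z | y + δ < z ∧ z ≤ G.yMax} (classColumns κ y c) (classColumns κ (y + δ) c) V Λ (N c) K
    (hcard c) (hrow c) (hN c)
  have hf : ∀ z x, x ≤ y → f (κ x y) z x ≤ y + δ ∧ κ (f (κ x y) z x) (y + δ) = κ x y :=
    fun z x hx => mem_classColumns.1 (hfU _ z x (mem_classColumns.2 ⟨hx, rfl⟩))
  refine ⟨fun z x => f (κ x y) z x, ⟨hG, hy, fun z x hx => (hf z x hx).1, ?_, ?_, ?_⟩, ?_⟩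
  · intro z x hx
    exact hκ x hx _ (hf z x hx).1 (hf z x hx).2.symm
  · intro x hx ψ hψ
    have hψN : ψ ∈ N (κ x y) := by
      refine Finset.mem_filter.2 ⟨φ.finite_futureArgs.mem_toFinset.2 hψ.1.1, fun u hu => ?_⟩
      obtain ⟨h1, h2⟩ := mem_classColumns.1 hu
      have hs := hκ x hx u h1 h2.symm
      rw [← hs.all, ← hs.seen]
      exact hψ
    obtain ⟨z, ⟨h1, h2⟩, h3⟩ := hfN _ x (mem_classColumns.2 ⟨hx, rfl⟩) ψ hψN
    exact ⟨z, h1, h2, h3⟩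
  · intro z ψ hψ u hu h
    obtain ⟨x, hx, hP⟩ := hfΛ (κ u (y + δ)) z ψ (φ.finite_pastArgs.mem_toFinset.2 hψ) u
      (mem_classColumns.2 ⟨hu, rfl⟩) h
    obtain ⟨h1, h2⟩ := mem_classColumns.1 hx
    exact ⟨x, h1, by rwa [h2]⟩
  · intro v hv hvy
    obtain ⟨x, hx, hP⟩ := hfV (κ v (y + δ)) v hv (mem_classColumns.2 ⟨hvy, rfl⟩)
    obtain ⟨h1, h2⟩ := mem_classColumns.1 hx
    exact ⟨x, h1, fun z => (congrArg (fun c => f c z x) h2).trans (hP z)⟩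

variable (G)

open Classical in
/-- The class of a point whose column meets all its requests. -/
noncomputable def fulfilledCode (x y : ℕ) :
    (φ.subformulae → Prop) × (φ.futureArgs → Fin 3) × Fin (φ.maxParam + 1) :=
  (fun α => α.1 ∈ G.label x y,
    -- Seen, to be seen later, never seen. When nothing stays pending the requests are exactly what
    -- is seen, so they need no further value.
    fun ψ => if ψ.1 ∈ G.seen x y then 0 else if ψ.1 ∈ G.seen x G.yMax then 1 else 2,
    ⟨min (y - x) φ.maxParam, by omega⟩)

open Classical in
/-- The class of an arbitrary point. -/
noncomputable def pointCode (x y : ℕ) :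
    (φ.subformulae → Prop) × (φ.futureArgs → Fin 4) × Fin (φ.maxParam + 1) :=
  (fun α => α.1 ∈ G.label x y,
    -- Whatever is seen is requested, so only never seen observables split into requested or not.
    fun ψ => if ψ.1 ∈ G.seen x y then 0 else if ψ.1 ∈ G.seen x G.yMax then 1
      else if ψ.1 ∈ φ.reqR (G.label x x) then 2 else 3,
    ⟨min (y - x) φ.maxParam, by omega⟩)

variable {G}

instance : Finite φ.subformulae := φ.finite_subformulae

instance : Finite φ.futureArgs := φ.finite_futureArgs

theorem card_fulfilledCode (φ : Formula AP) :
    Nat.card ((φ.subformulae → Prop) × (φ.futureArgs → Fin 3) × Fin (φ.maxParam + 1)) =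
      2 ^ φ.subformulae.ncard * 3 ^ φ.futureArgs.ncard * (φ.maxParam + 1) := by
  simp [Nat.card_prod, Nat.card_fun, mul_assoc]

theorem card_pointCode (φ : Formula AP) :
    Nat.card ((φ.subformulae → Prop) × (φ.futureArgs → Fin 4) × Fin (φ.maxParam + 1)) =
      2 ^ φ.subformulae.ncard * 4 ^ φ.futureArgs.ncard * (φ.maxParam + 1) := by
  simp [Nat.card_prod, Nat.card_fun, mul_assoc]

theorem label_eq_of_forall {x y u v : ℕ} (hxy : x ≤ y) (hy : y ≤ G.yMax) (huv : u ≤ v)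
    (hv : v ≤ G.yMax)
    (h : (fun α : φ.subformulae => α.1 ∈ G.label x y) = fun α => α.1 ∈ G.label u v) :
    G.label x y = G.label u v :=
  (G.isAtom x y hxy hy).eq_of_inter_eq (G.isAtom u v huv hv)
    fun α hα => iff_of_eq (congrFun h ⟨α, hα⟩)

theorem reqR_eq_seen {x : ℕ} (hx : x ≤ G.yMax) (h : G.pending x G.yMax = ∅) :
    φ.reqR (G.label x x) = G.seen x G.yMax := by
  rw [pending_eq hx, Set.sdiff_eq_empty] at h
  exact h.antisymm (seen_subset_reqR le_rfl)

theorem sameState_of_fulfilledCode_eq {x y u v : ℕ} (hxy : x ≤ y) (hy : y ≤ G.yMax) (huv : u ≤ v)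
    (hv : v ≤ G.yMax) (hpx : G.pending x G.yMax = ∅) (hpu : G.pending u G.yMax = ∅)
    (h : G.fulfilledCode x y = G.fulfilledCode u v) : G.SameState x y u v := by
  obtain ⟨h1, h'⟩ := Prod.ext_iff.1 h
  obtain ⟨h2, h3⟩ := Prod.ext_iff.1 h'
  have key : ∀ ψ, (ψ ∈ G.seen x y ↔ ψ ∈ G.seen u v) ∧
      (ψ ∈ G.seen x G.yMax ↔ ψ ∈ G.seen u G.yMax) := by
    intro ψ
    by_cases hψ : ψ ∈ φ.futureArgs
    · have h4 := congrFun h2 ⟨ψ, hψ⟩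
      have h5 := @seen_mono _ _ G x _ _ hy ψ
      have h6 := @seen_mono _ _ G u _ _ hv ψ
      simp only [fulfilledCode] at h4
      split_ifs at h4 <;> tauto
    · exact ⟨⟨fun h => (hψ h.1).elim, fun h => (hψ h.1).elim⟩,
        ⟨fun h => (hψ h.1).elim, fun h => (hψ h.1).elim⟩⟩
  have hall : G.seen x G.yMax = G.seen u G.yMax := Set.ext fun ψ => (key ψ).2
  refine ⟨label_eq_of_forall hxy hy huv hv h1, ?_, hall, Set.ext fun ψ => (key ψ).1,
    congrArg Fin.val h3⟩
  rw [reqR_eq_seen (by omega) hpx, reqR_eq_seen (by omega) hpu, hall]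

theorem sameState_of_pointCode_eq {x y u v : ℕ} (hxy : x ≤ y) (hy : y ≤ G.yMax) (huv : u ≤ v)
    (hv : v ≤ G.yMax) (h : G.pointCode x y = G.pointCode u v) : G.SameState x y u v := by
  obtain ⟨h1, h'⟩ := Prod.ext_iff.1 h
  obtain ⟨h2, h3⟩ := Prod.ext_iff.1 h'
  have key : ∀ ψ, (ψ ∈ G.seen x y ↔ ψ ∈ G.seen u v) ∧
      (ψ ∈ G.seen x G.yMax ↔ ψ ∈ G.seen u G.yMax) ∧
      (ψ ∈ φ.reqR (G.label x x) ↔ ψ ∈ φ.reqR (G.label u u)) := by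
    intro ψ
    by_cases hψ : ψ ∈ φ.futureArgs
    · have h4 := congrFun h2 ⟨ψ, hψ⟩
      have h5 := @seen_mono _ _ G x _ _ hy ψ
      have h6 := @seen_mono _ _ G u _ _ hv ψ
      have h7 := @seen_subset_reqR _ _ G x x le_rfl ψ
      have h8 := @seen_subset_reqR _ _ G u u le_rfl ψ
      simp only [pointCode] at h4
      split_ifs at h4 <;> tauto
    · refine ⟨⟨fun h => (hψ h.1).elim, fun h => (hψ h.1).elim⟩,
        ⟨fun h => (hψ h.1).elim, fun h => (hψ h.1).elim⟩,
        ⟨fun h => (hψ ?_).elim, fun h => (hψ ?_).elim⟩⟩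
      · exact mem_futureArgs le_rfl (hxy.trans hy) h
      · exact mem_futureArgs le_rfl (huv.trans hv) h
  exact ⟨label_eq_of_forall hxy hy huv hv h1, Set.ext fun ψ => (key ψ).2.2,
    Set.ext fun ψ => (key ψ).2.1, Set.ext fun ψ => (key ψ).1, congrArg Fin.val h3⟩

/-- A generator with two equivalent rows up to `yInf` can be shrunk. -/
theorem exists_shrink_low (hG : G.FulfillsL) {yInf : ℕ} (hInf : yInf + φ.maxParam ≤ G.yMax)
    (hmark : ∀ x ≤ G.yMax, ∃ x' ≤ yInf, G.marking x' yInf = G.marking x G.yMax)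
    (hpend : ∀ x ≤ yInf, G.pending x G.yMax = ∅)
    {x₀ y₀ : ℕ} (hxy₀ : x₀ ≤ y₀) (hy₀ : y₀ ≤ G.yMax) (hφ : φ ∈ G.label x₀ y₀)
    {y δ : ℕ} (hδ : 0 < δ) (hy : y + δ ≤ yInf) (hrow : y₀ ≤ y ∨ y + δ < y₀)
    (heq : RowEquiv G.fulfilledCode (2 ^ φ.subformulae.ncard * 3 ^ φ.futureArgs.ncard *
      (φ.maxParam + 1) + φ.pastArgs.ncard * (φ.futureArgs.ncard + 1) + 2) y (y + δ)) :
    ∃ G' : FinCompass φ, G'.IsNatGenerator ∧ G'.yMax < G.yMax := by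
  classical
  let C := (φ.subformulae → Prop) × (φ.futureArgs → Fin 3) × Fin (φ.maxParam + 1)
  have : Fintype C := Fintype.ofFinite C
  -- One tracked column for each class met on row `yInf` among the columns up to `y + δ`, so that no
  -- marked atom of that row is lost.
  let rep : C → ℕ := fun c =>
    if h : ∃ x ≤ y + δ, G.fulfilledCode x yInf = c then h.choose else 0
  have hrep : ∀ x ≤ y + δ, rep (G.fulfilledCode x yInf) ≤ y + δ ∧
      G.fulfilledCode (rep (G.fulfilledCode x yInf)) yInf = G.fulfilledCode x yInf := by
    intro x hx
    have h : ∃ x' ≤ y + δ, G.fulfilledCode x' yInf = G.fulfilledCode x yInf := ⟨x, hx, rfl⟩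
    simp only [rep, dif_pos h]
    exact h.choose_spec
  let V : Finset ℕ := insert x₀ (Finset.univ.image rep)
  have hV : V.card ≤ 2 ^ φ.subformulae.ncard * 3 ^ φ.futureArgs.ncard * (φ.maxParam + 1) + 1 := by
    rw [← card_fulfilledCode, Nat.card_eq_fintype_card]
    exact (Finset.card_insert_le _ _).trans (Nat.add_le_add_right Finset.card_image_le 1)
  obtain ⟨f, h, hfV⟩ := exists_contraction hG (by omega) G.fulfilledCode
    (fun x hx u hu he => sameState_of_fulfilledCode_eq hx (by omega) hu (by omega)
      (hpend x (by omega)) (hpend u (by omega)) he) V _ (by omega) heq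
  refine ⟨h.toFinCompass, isNatGenerator_iff.2 ⟨?_, h.fulfillsL_toFinCompass, yInf - δ, ?_, ?_, ?_⟩,
    by rw [h.yMax_eq]; omega⟩
  · exact h.features_toFinCompass hxy₀ hy₀ hφ hrow (hfV x₀ (Finset.mem_insert_self _ _))
  · rw [h.yMax_eq]; omega
  · have hlow : ∀ x ≤ yInf, ∃ x' ≤ yInf - δ,
        h.toFinCompass.marking x' (yInf - δ) = G.marking x yInf := by
      intro x hx
      rcases le_or_gt x (y + δ) with hxy | hxy
      · obtain ⟨h1, h2⟩ := hrep x hxy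
        obtain ⟨x', h3, h4⟩ := hfV _ (Finset.mem_insert_of_mem
          (Finset.mem_image_of_mem rep (Finset.mem_univ (G.fulfilledCode x yInf)))) h1
        set v := rep (G.fulfilledCode x yInf)
        refine ⟨x', by omega, ?_⟩
        have h5 : G.marking v yInf = G.marking x yInf :=
          (sameState_of_fulfilledCode_eq (by omega) (by omega) hx (by omega)
            (hpend _ (by omega)) (hpend _ hx) h2).marking_eq (by omega) (by omega)
        rw [← h5]
        -- If the cut ends exactly at `yInf`, the new marker row is `y` itself and equality of
        -- states replaces `marking_follow`.
        rcases hy.lt_or_eq with hlt | hyeq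
        · rw [h.marking_follow h4 h3 (by omega) (by omega), Nat.sub_add_cancel (by omega)]
        · have h6 : yInf - δ = y := by omega
          have h7 := h.sameState 0 x' h3
          rw [h4] at h7
          rw [h6, h.marking_low h3 le_rfl, h7.marking_eq (by omega) (by omega), hyeq]
      · refine ⟨x - δ, by omega, ?_⟩
        rw [h.marking_high (by omega) (by omega) (by omega), Nat.sub_add_cancel (by omega),
          Nat.sub_add_cancel (by omega)]
    intro x hx
    rw [h.yMax_eq] at hx ⊢
    -- Every new top marking is an old top marking, hence occurs on the old row `yInf`, hence on row
    -- `yInf - δ`.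
    have h1 : ∃ u ≤ G.yMax, h.toFinCompass.marking x (G.yMax - δ) = G.marking u G.yMax := by
      rcases le_or_gt x y with hxy | hxy
      · obtain ⟨u, hu, he⟩ := h.exists_marking_yMax hxy
        exact ⟨u, by omega, he⟩
      · refine ⟨x + δ, by omega, ?_⟩
        rw [h.marking_high hxy hx (by omega), Nat.sub_add_cancel (by omega)]
    obtain ⟨u, hu, he⟩ := h1
    obtain ⟨w, hw, hwe⟩ := hmark u hu
    rw [he, ← hwe]
    exact hlow w hw
  · intro x hx
    rw [h.yMax_eq]
    rcases le_or_gt x y with hxy | hxy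
    · rw [h.pending_yMax hxy, hpend x (by omega)]
    · have h1 := h.marking_high hxy (z := G.yMax - δ) (by omega) (by omega)
      rw [Nat.sub_add_cancel (by omega)] at h1
      exact (congrArg (fun t => t.2.1) h1).trans (hpend (x + δ) (by omega))

/-- A generator with two equivalent rows from `yInf + k_φ` on can be shrunk. -/
theorem exists_shrink_high (hG : G.FulfillsL) {yInf : ℕ}
    (hmark : ∀ x ≤ G.yMax, ∃ x' ≤ yInf, G.marking x' yInf = G.marking x G.yMax)
    (hpend : ∀ x ≤ yInf, G.pending x G.yMax = ∅)
    {x₀ y₀ : ℕ} (hxy₀ : x₀ ≤ y₀) (hy₀ : y₀ ≤ G.yMax) (hφ : φ ∈ G.label x₀ y₀)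
    {y δ : ℕ} (hδ : 0 < δ) (hy : yInf + φ.maxParam ≤ y) (hyM : y + δ ≤ G.yMax)
    (hrow : y₀ ≤ y ∨ y + δ < y₀)
    (heq : RowEquiv G.pointCode (φ.pastArgs.ncard * (φ.futureArgs.ncard + 1) + 2) y (y + δ)) :
    ∃ G' : FinCompass φ, G'.IsNatGenerator ∧ G'.yMax < G.yMax := by
  obtain ⟨f, h, hfV⟩ := exists_contraction hG hyM G.pointCode
    (fun x hx u hu he => sameState_of_pointCode_eq hx (by omega) hu hyM he) {x₀} _
    (by rw [Finset.card_singleton]) heq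
  refine ⟨h.toFinCompass, isNatGenerator_iff.2 ⟨?_, h.fulfillsL_toFinCompass, yInf, ?_, ?_, ?_⟩,
    by rw [h.yMax_eq]; omega⟩
  · exact h.features_toFinCompass hxy₀ hy₀ hφ hrow (hfV x₀ (Finset.mem_singleton_self _))
  -- The rows up to `y` remain and `yInf + φ.maxParam ≤ y`, so the required gap survives.
  · rw [h.yMax_eq]; omega
  · intro x hx
    rw [h.yMax_eq] at hx ⊢
    have h1 : ∃ u ≤ G.yMax, h.toFinCompass.marking x (G.yMax - δ) = G.marking u G.yMax := by
      rcases le_or_gt x y with hxy | hxy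
      · obtain ⟨u, hu, he⟩ := h.exists_marking_yMax hxy
        exact ⟨u, by omega, he⟩
      · refine ⟨x + δ, by omega, ?_⟩
        rw [h.marking_high hxy hx (by omega), Nat.sub_add_cancel (by omega)]
    obtain ⟨u, hu, he⟩ := h1
    obtain ⟨w, hw, hwe⟩ := hmark u hu
    exact ⟨w, hw, by rw [h.marking_low hw (by omega), he, hwe]⟩
  · intro x hx
    rw [h.yMax_eq, h.pending_yMax (by omega), hpend x hx]

/-- A generator with too many rows can be shrunk. -/
theorem IsNatGenerator.exists_lt (hgen : G.IsNatGenerator)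
    (hlarge : 2 * (2 ^ φ.subformulae.ncard * 3 ^ φ.futureArgs.ncard * (φ.maxParam + 1) +
        φ.pastArgs.ncard * (φ.futureArgs.ncard + 1) + 3) ^
        (2 ^ φ.subformulae.ncard * 3 ^ φ.futureArgs.ncard * (φ.maxParam + 1)) + φ.maxParam +
      2 * (φ.pastArgs.ncard * (φ.futureArgs.ncard + 1) + 3) ^
        (2 ^ φ.subformulae.ncard * 4 ^ φ.futureArgs.ncard * (φ.maxParam + 1)) < G.yMax + 1) :
    ∃ G' : FinCompass φ, G'.IsNatGenerator ∧ G'.yMax < G.yMax := by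
  obtain ⟨⟨x₀, y₀, hxy₀, hy₀, hφ⟩, hG, yInf, hInf, hmark, hpend⟩ := isNatGenerator_iff.1 hgen
  rw [← card_fulfilledCode, ← card_pointCode] at hlarge
  by_cases h1 : 2 * (2 ^ φ.subformulae.ncard * 3 ^ φ.futureArgs.ncard * (φ.maxParam + 1) +
      φ.pastArgs.ncard * (φ.futureArgs.ncard + 1) + 2 + 1) ^ Nat.card
        ((φ.subformulae → Prop) × (φ.futureArgs → Fin 3) × Fin (φ.maxParam + 1)) <
      (Finset.range (yInf + 1)).card
  · obtain ⟨y, -, y', hy', hlt, hrow, heq⟩ := exists_rowEquiv G.fulfilledCode _ y₀ _ h1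
    obtain ⟨δ, rfl⟩ := Nat.exists_eq_add_of_lt hlt
    rw [add_assoc] at hy' hrow heq
    exact exists_shrink_low hG hInf hmark hpend hxy₀ hy₀ hφ (Nat.succ_pos δ)
      (Nat.lt_succ_iff.1 (Finset.mem_range.1 hy')) hrow heq
  · rw [Finset.card_range] at h1
    have h2 : 2 * (φ.pastArgs.ncard * (φ.futureArgs.ncard + 1) + 2 + 1) ^ Nat.card
        ((φ.subformulae → Prop) × (φ.futureArgs → Fin 4) × Fin (φ.maxParam + 1)) <
        (Finset.Icc (yInf + φ.maxParam) G.yMax).card := by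
      rw [Nat.card_Icc]
      rw [← card_fulfilledCode] at h1
      simp only [add_assoc, Nat.reduceAdd] at h1 hlarge ⊢
      omega
    obtain ⟨y, hy, y', hy', hlt, hrow, heq⟩ := exists_rowEquiv G.pointCode _ y₀ _ h2
    obtain ⟨δ, rfl⟩ := Nat.exists_eq_add_of_lt hlt
    rw [add_assoc] at hy' hrow heq
    exact exists_shrink_high hG hmark hpend hxy₀ hy₀ hφ (Nat.succ_pos δ)
      (Finset.mem_Icc.1 hy).1 (Finset.mem_Icc.1 hy').2 hrow heq

end MPNL.FinCompass

theorem mainTheorem6 {AP : Type*} (φ : MPNL.Formula AP)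
    (hφ : ∃ G : MPNL.FinCompass φ, G.IsNatGenerator ∧ G.Features φ) :
    ∃ G' : MPNL.FinCompass φ, G'.IsNatGenerator ∧ G'.Features φ ∧
      (G'.domain.ncard : ℝ) ≤
        ((2 : ℝ) ^ (3 * φ.length) + 2) *
          ((φ.length : ℝ) ^ 2 / 4 + (φ.length : ℝ) / 2 + 1) ^ (2 ^ (3 * φ.length)) + 1 := by
  classical
  have hex : ∃ n, ∃ G : MPNL.FinCompass φ, G.IsNatGenerator ∧ G.yMax = n :=
    let ⟨G, hG, _⟩ := hφ
    ⟨_, G, hG, rfl⟩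
  -- A generator with the least `yMax` cannot be shrunk further.
  obtain ⟨G, hG, hmin⟩ := Nat.find_spec hex
  refine ⟨G, hG, hG.features, ?_⟩
  have hdom : G.domain.ncard = G.yMax + 1 := by
    rw [MPNL.FinCompass.domain, ← Finset.coe_Iic, Set.ncard_coe_finset, Nat.card_Iic]
  refine le_trans ?_ (row_bound_le (Nat.lt_size_self φ.maxParam) φ.ncard_subformulae_add_size_le
    φ.ncard_args_add_size_lt)
  rw [hdom, Nat.cast_le]
  by_contra hlt
  obtain ⟨G', hG', hG'lt⟩ := hG.exists_lt (not_le.1 hlt)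
  exact Nat.find_min hex (hmin ▸ hG'lt) ⟨G', hG', rfl⟩
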